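/- Let $D\ge 1$, $m$, $n$ be integers and let $\Lambda\subseteq\mathbb{Z}^D$ be a sublattice of rank $D$ with $|\mathbb{Z}^D/\Lambda|=n$. Let $\mathcal{C}$ be a stabilizer code of length $N=mn$, given by stabilizer generators, that is, by a set of $N$-qubit Pauli operators generating an abelian group that does not contain $-I$. Suppose that the qubits are indexed by the vertices of $\mathbb{Z}^D/\Lambda$, each vertex indexing exactly $m$ qubits, and that there is a real number $\rho>0$ such that the support of every stabilizer generator is contained in a closed Euclidean ball of radius $\rho$ of $\mathbb{R}^D/\Lambda$, for the distance $\mathrm{dist}([a],[b])=\inf_{g\in\Lambda}\|a-(b+g)\|$ (the centre may be any point of $\mathbb{R}^D/\Lambda$ and may depend on the generator). Let $$\gamma_D=\max_{L}\ \min_{x\in L\setminus\{0\}}\left(\frac{\|x\|}{\mathrm{vol}(L)^{1/D}}\right)^2$$ be the Hermite constant, where $L$ ranges over the full-rank lattices of $\mathbb{R}^D$, and suppose that $n^{1/D}\ge 8\rho\sqrt{\gamma_D}$. Let $\mathbf{H}=(\mathbf{A}_X\,|\,\mathbf{A}_Z)$ be the binary parity-check matrix of $\mathcal{C}$, whose rows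 are the vectors $(x\,|\,z)$ of the generators $\alpha\bigotimes_{i=1}^N X^{x_i}Z^{z_i}$, and let $d$ be the minimum distance of $\mathcal{C}$, that is, the smallest weight $|\{i : (x_i,z_i)\neq(0,0)\}|$ of a vector $(x\,|\,z)\in\mathbb{F}_2^{2N}$ that is orthogonal to all rows of $\mathbf{H}$ for the symplectic form and is not in the row space of $\mathbf{H}$ (such a vector is assumed to exist, i.e. the code has at least one logical qubit). Then $$d< m\sqrt{\gamma_D}\,\bigl(\sqrt{D}+4\rho\bigr)\,n^{\frac{D-1}{D}}.$$ -/

import Mathlib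

open scoped BigOperators

noncomputable section

/-! ### Stabilizer codes on a finite set `Q` of qubits -/

/-- The bit-flip matrix `X`. -/
def pauliX : Matrix (Fin 2) (Fin 2) ℂ := !![0, 1; 1, 0]

/-- The phase-flip matrix `Z`. -/
def pauliZ : Matrix (Fin 2) (Fin 2) ℂ := !![1, 0; 0, -1]

/-- Binary vectors `(x | z)` of length `2N`, where `N` is the number of qubits. -/
abbrev BinaryVec (Q : Type) : Type := (Q → ZMod 2) × (Q → ZMod 2)

/-- The tensor product over all qubits `q` of the matrices `X ^ x_q * Z ^ z_q`, as an operator on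
`(ℂ²)^{⊗ Q}`, whose standard basis is indexed by the maps `Q → Fin 2`. -/
def pauliTensor {Q : Type} [Fintype Q] (v : BinaryVec Q) :
    Matrix (Q → Fin 2) (Q → Fin 2) ℂ :=
  Matrix.of fun a b => ∏ q, (pauliX ^ (v.1 q).val * pauliZ ^ (v.2 q).val) (a q) (b q)

/-- `g` is the Pauli operator `α • ⨂ X ^ x_q * Z ^ z_q` with `α ∈ {1, -1, i, -i}` and
`v = (x | z)`; since `Y = i X Z`, the operators of this form, for some `v`, are exactly the
elements of the Pauli group. -/
def IsPauliWithVec {Q : Type} [Fintype Q] [DecidableEq Q]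
    (g : GL (Q → Fin 2) ℂ) (v : BinaryVec Q) : Prop :=
  ∃ α : ℂ, α ^ 4 = 1 ∧ (g : Matrix (Q → Fin 2) (Q → Fin 2) ℂ) = α • pauliTensor v

/-- A stabilizer code on the qubits `Q`, given by stabilizer generators: Pauli operators that
generate an abelian group which does not contain `-I`. -/
structure StabilizerCode (Q : Type) [Fintype Q] [DecidableEq Q] where
  generators : Set (GL (Q → Fin 2) ℂ)
  isPauli : ∀ g ∈ generators, ∃ v, IsPauliWithVec g v
  commute : ∀ g ∈ Subgroup.closure generators, ∀ h ∈ Subgroup.closure generators, g * h = h * g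
  neg_one_notMem : (-1 : GL (Q → Fin 2) ℂ) ∉ Subgroup.closure generators

/-- The rows of the parity-check matrix `(A_X | A_Z)`: the binary vectors of the generators. -/
def StabilizerCode.parityChecks {Q : Type} [Fintype Q] [DecidableEq Q] (C : StabilizerCode Q) :
    Set (BinaryVec Q) :=
  {v | ∃ g ∈ C.generators, IsPauliWithVec g v}

/-- The symplectic inner product `x · z' + z · x'` of `(x | z)` and `(x' | z')`. -/
def symplecticForm {Q : Type} [Fintype Q] (v w : BinaryVec Q) : ZMod 2 :=
  ∑ q, (v.1 q * w.2 q + v.2 q * w.1 q)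

/-- The support of `(x | z)`: the qubits on which the Pauli operator acts non-trivially. -/
def BinaryVec.support {Q : Type} [Fintype Q] (v : BinaryVec Q) : Finset Q :=
  Finset.univ.filter fun q => v.1 q ≠ 0 ∨ v.2 q ≠ 0

/-- `d` is the minimum distance of `C`: the smallest weight (number of qubits in the support) of a
vector that is orthogonal to every row of the parity-check matrix but does not belong to the
row space. (There is such a `d` exactly when the code has at least one logical qubit.) -/
def StabilizerCode.IsMinDistance {Q : Type} [Fintype Q] [DecidableEq Q]
    (C : StabilizerCode Q) (d : ℕ) : Prop :=
  IsLeast {w : ℕ | ∃ v : BinaryVec Q,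
    (∀ h ∈ C.parityChecks, symplecticForm h v = 0) ∧
    v ∉ Submodule.span (ZMod 2) C.parityChecks ∧
    v.support.card = w} d

/-! ### Lattices -/

/-- The inclusion of `ℤ^D` into Euclidean space `ℝ^D`. -/
def intVec {D : ℕ} (a : Fin D → ℤ) : EuclideanSpace ℝ (Fin D) :=
  WithLp.toLp 2 fun i => (a i : ℝ)

/-- The distance `inf_{g ∈ Λ} ‖a - (b + g)‖` between the classes of `a` and `b` in `ℝ^D / Λ`. -/
def quotientDist {D : ℕ} (Λ : Submodule ℤ (Fin D → ℤ)) (a b : EuclideanSpace ℝ (Fin D)) : ℝ :=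
  ⨅ g : Λ, ‖a - (b + intVec (g : Fin D → ℤ))‖

/-- The vertices of `ℤ^D / Λ` in the closed Euclidean ball of `ℝ^D / Λ` of radius `ρ` centred at
the class of `c`. -/
def quotientBall {D : ℕ} (Λ : Submodule ℤ (Fin D → ℤ)) (c : EuclideanSpace ℝ (Fin D)) (ρ : ℝ) :
    Set ((Fin D → ℤ) ⧸ Λ) :=
  {p | ∃ a : Fin D → ℤ, Submodule.Quotient.mk a = p ∧ quotientDist Λ (intVec a) c ≤ ρ}

/-- `γ_D(L)`: the minimum of `(‖x‖ / vol(L)^{1/D})²` over the non-zero vectors `x` of `L`. -/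
def hermiteInvariant {D : ℕ} (L : Submodule ℤ (EuclideanSpace ℝ (Fin D))) : ℝ :=
  sInf {r : ℝ | ∃ x ∈ L, x ≠ 0 ∧ r = (‖x‖ / ZLattice.covolume L ^ (1 / (D : ℝ))) ^ 2}

/-- The Hermite constant `γ_D` (`D ≥ 1`): the maximum of `γ_D(L)` over all full-rank lattices `L`
of `ℝ^D`. -/
def hermiteConstant (D : ℕ) : ℝ :=
  sSup {r : ℝ | ∃ L : Submodule ℤ (EuclideanSpace ℝ (Fin D)),
    ∃ _ : DiscreteTopology L, IsZLattice ℝ L ∧ r = hermiteInvariant L}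

end

/-! ### Commuting Pauli operators -/

/-! The lattice torus is cut into thin strips transverse to a short dual vector; if no strip could
support a logical operator, there would be no logical operator at all. Geometry: a shortest vector
`u` of a dual lattice of covolume `1/n` satisfies the Hermite bound, so `a = n • u` is an integer
vector of norm at most `√γ_D * n^((D-1)/D)` (`exists_short_dual_vector`). The scalar product with
`a` maps the vertices to the circle `ℤ/n`, and two vertices in a common ball of radius `ρ` land at
circular distance at most `2ρ‖a‖` (`exists_abs_sub_le_of_mem_quotientBall`). Cut the circle into
`2s` equal slices of width between `2ρ‖a‖` and `4ρ‖a‖`: a check then meets at most two slices,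
adjacent ones, hence never two distinct slices of the same parity (`slice_eq_of_parity_eq`). A slice
contains fewer than `n/(2s) + e` vertices, where `e ≤ ‖a‖` is the order of the kernel
(`exists_slice_bound`, `le_norm_intVec_of_dvd_dotHom`). Coding: suppose every slice carries fewer
than `d` qubits. Each slice is then correctable, so is the union of the even slices and that of the
odd slices (`isCorrectable_of_fibers`). Two complementary correctable sets leave no logical qubit
(`IsCorrectable.mem_span_of_compl`), a contradiction. So some slice carries at least `d` qubits, and
the count bounds `d`. -/

lemma zmod_two_eq_zero_or_one (x : ZMod 2) : x = 0 ∨ x = 1 := by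
  revert x; decide

lemma neg_one_pow_val_add (a b : ZMod 2) :
    (-1 : ℂ) ^ (a + b).val = (-1) ^ a.val * (-1) ^ b.val := by
  rcases zmod_two_eq_zero_or_one a with rfl | rfl <;>
    rcases zmod_two_eq_zero_or_one b with rfl | rfl <;>
    simp [ZMod.val_one, CharTwo.add_self_eq_zero]

lemma pauli_mul_pauli (x z x' z' : ZMod 2) :
    (pauliX ^ x.val * pauliZ ^ z.val) * (pauliX ^ x'.val * pauliZ ^ z'.val) =
      ((-1 : ℂ) ^ (x * z' + z * x').val) •
        ((pauliX ^ x'.val * pauliZ ^ z'.val) * (pauliX ^ x.val * pauliZ ^ z.val)) := by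
  rw [neg_one_pow_val_add]
  rcases zmod_two_eq_zero_or_one x with rfl | rfl <;>
    rcases zmod_two_eq_zero_or_one z with rfl | rfl <;>
    rcases zmod_two_eq_zero_or_one x' with rfl | rfl <;>
    rcases zmod_two_eq_zero_or_one z' with rfl | rfl <;>
    simp [pauliX, pauliZ, ZMod.val_one]

lemma pauliTensor_mul_apply {Q : Type} [Fintype Q] [DecidableEq Q] (v w : BinaryVec Q)
    (a b : Q → Fin 2) :
    (pauliTensor v * pauliTensor w) a b =
      ∏ q, ((pauliX ^ (v.1 q).val * pauliZ ^ (v.2 q).val) *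
        (pauliX ^ (w.1 q).val * pauliZ ^ (w.2 q).val)) (a q) (b q) := by
  rw [Matrix.mul_apply]
  simp only [pauliTensor, Matrix.of_apply, ← Finset.prod_mul_distrib]
  simp_rw [Matrix.mul_apply (M := pauliX ^ _ * pauliZ ^ _)]
  -- Distributivity: a product over qubits of sums over `Fin 2` is a sum over all basis labels `Q →
  -- Fin 2`.
  rw [Finset.prod_univ_sum, Fintype.piFinset_univ]

lemma neg_one_pow_val_sum {Q : Type} (s : Finset Q) (f : Q → ZMod 2) :
    (-1 : ℂ) ^ (∑ q ∈ s, f q).val = ∏ q ∈ s, (-1) ^ (f q).val := by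
  classical
  induction s using Finset.induction_on with
  | empty => simp
  | insert a s ha ih => rw [Finset.sum_insert ha, Finset.prod_insert ha, neg_one_pow_val_add, ih]

lemma pauliTensor_mul_comm {Q : Type} [Fintype Q] [DecidableEq Q] (v w : BinaryVec Q) :
    pauliTensor v * pauliTensor w =
      ((-1 : ℂ) ^ (symplecticForm v w).val) • (pauliTensor w * pauliTensor v) := by
  ext a b
  rw [Matrix.smul_apply, pauliTensor_mul_apply, pauliTensor_mul_apply, symplecticForm,
    neg_one_pow_val_sum, smul_eq_mul, ← Finset.prod_mul_distrib]
  refine Finset.prod_congr rfl fun q _ => ?_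
  rw [pauli_mul_pauli, Matrix.smul_apply, smul_eq_mul]

/-- Swapping the operators costs the sign `(-1)^symplecticForm v w`. If it were `-1`, then `h * g`
would equal its own negative and vanish, which an invertible matrix cannot. -/
lemma symplecticForm_eq_zero_of_commute {Q : Type} [Fintype Q] [DecidableEq Q]
    {g h : GL (Q → Fin 2) ℂ} {v w : BinaryVec Q} (hg : IsPauliWithVec g v)
    (hh : IsPauliWithVec h w) (hgh : g * h = h * g) : symplecticForm v w = 0 := by
  obtain ⟨α, -, hgv⟩ := hg
  obtain ⟨β, -, hhw⟩ := hh
  have key : ((g * h : GL (Q → Fin 2) ℂ) : Matrix (Q → Fin 2) (Q → Fin 2) ℂ) =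
      ((-1 : ℂ) ^ (symplecticForm v w).val) •
        ((h * g : GL (Q → Fin 2) ℂ) : Matrix (Q → Fin 2) (Q → Fin 2) ℂ) := by
    rw [Units.val_mul, Units.val_mul, hgv, hhw, smul_mul_smul_comm, smul_mul_smul_comm,
      pauliTensor_mul_comm v w, smul_comm, mul_comm α β]
  by_contra hne
  have h1 : symplecticForm v w = 1 := (zmod_two_eq_zero_or_one _).resolve_left hne
  rw [h1, hgh] at key
  have h2 : ((h * g : GL (Q → Fin 2) ℂ) : Matrix (Q → Fin 2) (Q → Fin 2) ℂ) = 0 := by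
    rw [ZMod.val_one, pow_one, neg_one_smul] at key
    ext a b
    exact self_eq_neg.mp (congrFun (congrFun key a) b)
  exact (h * g).ne_zero h2

lemma StabilizerCode.symplecticForm_parityChecks {Q : Type} [Fintype Q] [DecidableEq Q]
    (C : StabilizerCode Q) {v w : BinaryVec Q} (hv : v ∈ C.parityChecks)
    (hw : w ∈ C.parityChecks) : symplecticForm v w = 0 := by
  obtain ⟨g, hg, hgv⟩ := hv
  obtain ⟨h, hh, hhw⟩ := hw
  exact symplecticForm_eq_zero_of_commute hgv hhw
    (C.commute g (Subgroup.subset_closure hg) h (Subgroup.subset_closure hh))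

/-! ### Restriction and support of binary vectors -/

section Restriction

variable {Q : Type}

/-- The restriction of a binary vector to a set of qubits, extended by zero. -/
noncomputable def BinaryVec.restrict (A : Set Q) : BinaryVec Q →ₗ[ZMod 2] BinaryVec Q := by
  classical
  exact
  { toFun := fun v => (fun q => if q ∈ A then v.1 q else 0, fun q => if q ∈ A then v.2 q else 0)
    map_add' := fun v w => by
      ext q <;> by_cases hq : q ∈ A <;> simp [hq]
    map_smul' := fun c v => by
      ext q <;> by_cases hq : q ∈ A <;> simp [hq] }

open Classical in
lemma BinaryVec.restrict_fst (A : Set Q) (v : BinaryVec Q) (q : Q) :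
    (BinaryVec.restrict A v).1 q = if q ∈ A then v.1 q else 0 := by
  simp [BinaryVec.restrict]

open Classical in
lemma BinaryVec.restrict_snd (A : Set Q) (v : BinaryVec Q) (q : Q) :
    (BinaryVec.restrict A v).2 q = if q ∈ A then v.2 q else 0 := by
  simp [BinaryVec.restrict]

/-- The binary vectors supported in a set of qubits. -/
def supportedIn (A : Set Q) : Submodule (ZMod 2) (BinaryVec Q) where
  carrier := {v | ∀ q ∉ A, v.1 q = 0 ∧ v.2 q = 0}
  zero_mem' := fun _ _ => ⟨rfl, rfl⟩
  add_mem' := fun hv hw q hq => by simp [hv q hq, hw q hq]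
  smul_mem' := fun c v hv q hq => by simp [hv q hq]

lemma mem_supportedIn {A : Set Q} {v : BinaryVec Q} :
    v ∈ supportedIn A ↔ ∀ q ∉ A, v.1 q = 0 ∧ v.2 q = 0 := Iff.rfl

lemma restrict_mem_supportedIn (A : Set Q) (v : BinaryVec Q) :
    BinaryVec.restrict A v ∈ supportedIn A := fun q hq => by
  simp [BinaryVec.restrict_fst, BinaryVec.restrict_snd, hq]

end Restriction

/-! ### The symplectic form as a bilinear form -/

section Symplectic

variable {Q : Type} [Fintype Q]

/-- The symplectic form as a bilinear form. -/
def symplecticBilin (Q : Type) [Fintype Q] : LinearMap.BilinForm (ZMod 2) (BinaryVec Q) :=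
  LinearMap.mk₂ (ZMod 2) symplecticForm
    (fun v v' w => by
      simp only [symplecticForm, ← Finset.sum_add_distrib]
      exact Finset.sum_congr rfl fun q _ => by simp; ring)
    (fun c v w => by
      simp only [symplecticForm, smul_eq_mul, Finset.mul_sum]
      exact Finset.sum_congr rfl fun q _ => by simp; ring)
    (fun v w w' => by
      simp only [symplecticForm, ← Finset.sum_add_distrib]
      exact Finset.sum_congr rfl fun q _ => by simp; ring)
    (fun c v w => by
      simp only [symplecticForm, smul_eq_mul, Finset.mul_sum]
      exact Finset.sum_congr rfl fun q _ => by simp; ring)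

@[simp] lemma symplecticBilin_apply (v w : BinaryVec Q) :
    symplecticBilin Q v w = symplecticForm v w := rfl

lemma symplecticForm_comm (v w : BinaryVec Q) : symplecticForm v w = symplecticForm w v :=
  Finset.sum_congr rfl fun q _ => by ring

lemma symplecticBilin_isRefl : (symplecticBilin Q).IsRefl := fun v w h => by
  rw [symplecticBilin_apply] at h ⊢
  rwa [symplecticForm_comm]

lemma symplecticForm_single_right [DecidableEq Q] (v : BinaryVec Q) (q : Q) :
    symplecticForm v (0, Pi.single q 1) = v.1 q := by
  simp [symplecticForm, Pi.single_apply]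

lemma symplecticForm_single_left [DecidableEq Q] (v : BinaryVec Q) (q : Q) :
    symplecticForm v (Pi.single q 1, 0) = v.2 q := by
  simp [symplecticForm, Pi.single_apply]

lemma symplecticBilin_nondegenerate : (symplecticBilin Q).Nondegenerate := by
  classical
  have h : ∀ v : BinaryVec Q, (∀ w, symplecticForm v w = 0) → v = 0 := fun v hv =>
    Prod.ext (funext fun q => by simpa [symplecticForm_single_right] using hv (0, Pi.single q 1))
      (funext fun q => by simpa [symplecticForm_single_left] using hv (Pi.single q 1, 0))
  exact ⟨h, fun v hv => h v fun w => by rw [symplecticForm_comm]; exact hv w⟩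

lemma BinaryVec.mem_support {v : BinaryVec Q} {q : Q} :
    q ∈ v.support ↔ v.1 q ≠ 0 ∨ v.2 q ≠ 0 := by
  simp [BinaryVec.support]

lemma support_subset_of_mem_supportedIn {A : Set Q} {v : BinaryVec Q} (hv : v ∈ supportedIn A)
    {q : Q} (hq : q ∈ v.support) : q ∈ A := by
  by_contra hqA
  have := hv q hqA
  rw [BinaryVec.mem_support] at hq
  tauto

/-- Pairing with a single `X` or `Z` at a qubit outside `A` reads off one coordinate there;
conversely disjoint supports pair to zero. -/
lemma orthogonal_supportedIn_compl (A : Set Q) :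
    (symplecticBilin Q).orthogonal (supportedIn Aᶜ) = supportedIn A := by
  classical
  ext v
  rw [LinearMap.BilinForm.mem_orthogonal_iff]
  constructor
  · intro h q hq
    constructor
    · rw [← symplecticForm_single_right v q, symplecticForm_comm]
      refine h _ fun (r : Q) hr => ⟨rfl, ?_⟩
      exact Pi.single_eq_of_ne (fun e : r = q => hr (e ▸ hq)) _
    · rw [← symplecticForm_single_left v q, symplecticForm_comm]
      refine h _ fun (r : Q) hr => ⟨?_, rfl⟩
      exact Pi.single_eq_of_ne (fun e : r = q => hr (e ▸ hq)) _
  · intro h w hw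
    rw [symplecticBilin_apply]
    refine Finset.sum_eq_zero fun q _ => ?_
    by_cases hq : q ∈ A
    · simp [hw q (by simpa using hq)]
    · simp [h q hq]

lemma symplecticForm_restrict_eq_self {A : Set Q} {h v : BinaryVec Q}
    (hA : ∀ q ∈ h.support, q ∈ v.support → q ∈ A) :
    symplecticForm h (BinaryVec.restrict A v) = symplecticForm h v := by
  refine Finset.sum_congr rfl fun q _ => ?_
  rw [BinaryVec.restrict_fst, BinaryVec.restrict_snd]
  split_ifs with hq
  · rfl
  · have := mt (fun hh : q ∈ h.support ∧ q ∈ v.support => hA q hh.1 hh.2) hq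
    simp only [BinaryVec.mem_support] at this
    push Not at this
    by_cases h1 : h.1 q ≠ 0 ∨ h.2 q ≠ 0
    · simp [this h1]
    · push Not at h1
      simp [h1]

/-! ### Correctable sets of qubits -/

/-- A set of qubits is correctable for a set of parity checks if every vector orthogonal to the
checks and supported in the set is in the row space. -/
def IsCorrectable (P : Set (BinaryVec Q)) (A : Set Q) : Prop :=
  ∀ v ∈ supportedIn A, (∀ h ∈ P, symplecticForm h v = 0) → v ∈ Submodule.span (ZMod 2) P

lemma mem_orthogonal_span_iff {P : Set (BinaryVec Q)} {v : BinaryVec Q} :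
    v ∈ (symplecticBilin Q).orthogonal (Submodule.span (ZMod 2) P) ↔
      ∀ h ∈ P, symplecticForm h v = 0 := by
  rw [LinearMap.BilinForm.mem_orthogonal_iff]
  refine ⟨fun hv h hh => hv h (Submodule.subset_span hh), fun hv h hh => ?_⟩
  induction hh using Submodule.span_induction with
  | mem x hx => exact hv x hx
  | zero => simp
  | add x y _ _ hx hy => rw [map_add, LinearMap.add_apply, hx, hy, add_zero]
  | smul a x _ hx => rw [map_smul, LinearMap.smul_apply, hx, smul_zero]

/-- If a set of qubits and its complement are both correctable, the code has no logical qubit. -/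
lemma IsCorrectable.mem_span_of_compl {P : Set (BinaryVec Q)}
    (hP : ∀ v ∈ P, ∀ w ∈ P, symplecticForm v w = 0) {A : Set Q} (hA : IsCorrectable P A)
    (hAc : IsCorrectable P Aᶜ) {v : BinaryVec Q} (hv : ∀ h ∈ P, symplecticForm h v = 0) :
    v ∈ Submodule.span (ZMod 2) P := by
  set B := symplecticBilin Q
  set S := Submodule.span (ZMod 2) P
  have hSS : S ≤ B.orthogonal S := Submodule.span_le.2 fun w hw =>
    mem_orthogonal_span_iff.2 fun h hh => hP h hh w hw
  -- Orthogonality to everything supported in `Aᶜ` forces support in `A`, where correctability of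
  -- `A` applies. Taking orthogonals again writes any `v` orthogonal to `S` as an element of `S`
  -- plus a vector supported in `Aᶜ`.
  have hle : B.orthogonal (S ⊔ supportedIn Aᶜ) ≤ S := fun w hw =>
    hA w (orthogonal_supportedIn_compl A ▸ B.orthogonal_le le_sup_right hw)
      (mem_orthogonal_span_iff.1 (B.orthogonal_le le_sup_left hw))
  have hv' : v ∈ S ⊔ supportedIn Aᶜ := by
    rw [← LinearMap.BilinForm.orthogonal_orthogonal symplecticBilin_nondegenerate
      symplecticBilin_isRefl (S ⊔ supportedIn Aᶜ)]
    exact B.orthogonal_le hle (mem_orthogonal_span_iff.2 hv)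
  obtain ⟨s, hs, w, hw, rfl⟩ := Submodule.mem_sup.1 hv'
  refine S.add_mem hs (hAc w hw (mem_orthogonal_span_iff.1 ?_))
  -- Since `S` is isotropic, removing `s ∈ S` from `v` preserves orthogonality to `S`.
  have := (B.orthogonal S).sub_mem (mem_orthogonal_span_iff.2 hv) (hSS hs)
  rwa [add_sub_cancel_left] at this

/-- A disjoint union of correctable sets, no two of which meet a common check, is correctable. -/
lemma isCorrectable_of_fibers {P : Set (BinaryVec Q)} {ι : Type} [DecidableEq ι] (f : Q → ι)
    (A : Set Q) (hf : ∀ i, IsCorrectable P (f ⁻¹' {i}))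
    (hloc : ∀ h ∈ P, ∀ q ∈ h.support, ∀ r ∈ h.support, q ∈ A → r ∈ A → f q = f r) :
    IsCorrectable P A := by
  classical
  intro v hvA hv
  have hsum : v = ∑ i ∈ Finset.univ.image f, BinaryVec.restrict (f ⁻¹' {i}) v := by
    ext q
    · simp [Prod.fst_sum, Finset.sum_apply, BinaryVec.restrict_fst]
    · simp [Prod.snd_sum, Finset.sum_apply, BinaryVec.restrict_snd]
  rw [hsum]
  refine Submodule.sum_mem _ fun i _ => hf i _ (restrict_mem_supportedIn _ _) fun h hh => ?_
  -- If `h` meets `A` in colour `i`, all of its qubits in `A` have that colour, so restricting `v`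
  -- does not change the pairing. Otherwise `h` misses the support of the restriction.
  by_cases hi : ∃ q ∈ h.support, q ∈ A ∧ f q = i
  · obtain ⟨q, hq, hqA, rfl⟩ := hi
    rw [symplecticForm_restrict_eq_self, hv h hh]
    exact fun r hr hrv => hloc h hh r hr q hq (support_subset_of_mem_supportedIn hvA hrv) hqA
  · refine Finset.sum_eq_zero fun q _ => ?_
    rw [BinaryVec.restrict_fst, BinaryVec.restrict_snd]
    split_ifs with hq
    · by_cases hqh : q ∈ h.support
      · have hqA : q ∉ A := fun hqA => hi ⟨q, hqh, hqA, hq⟩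
        simp [hvA q hqA]
      · rw [BinaryVec.mem_support] at hqh
        push Not at hqh
        simp [hqh]
    · simp

end Symplectic

/-! ### Minimum distance and colourings of the qubits -/

/-- If the qubits are coloured so that a check never meets two different colours of the same
parity, then some colour class has at least as many elements as the minimum distance. -/
lemma StabilizerCode.IsMinDistance.exists_le_ncard_fiber {Q : Type} [Fintype Q] [DecidableEq Q]
    {C : StabilizerCode Q} {d : ℕ} (hd : C.IsMinDistance d) (f : Q → ℕ)
    (hf : ∀ h ∈ C.parityChecks, ∀ q ∈ h.support, ∀ r ∈ h.support,
      f q % 2 = f r % 2 → f q = f r) :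
    ∃ i, d ≤ (f ⁻¹' {i}).ncard := by
  by_contra! hlt
  have hcor : ∀ i, IsCorrectable C.parityChecks (f ⁻¹' {i}) := fun i v hvA hv => by
    by_contra hvS
    have h1 : d ≤ v.support.card := hd.2 ⟨v, hv, hvS, rfl⟩
    have h2 : v.support.card ≤ (f ⁻¹' {i}).ncard := by
      rw [← Set.ncard_coe_finset]
      exact Set.ncard_le_ncard (fun q hq => support_subset_of_mem_supportedIn hvA hq)
        (Set.toFinite _)
    exact (h1.trans h2).not_gt (hlt i)
  obtain ⟨v, hv, hvS, -⟩ := hd.1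
  refine hvS (IsCorrectable.mem_span_of_compl (A := {q | f q % 2 = 0})
    (fun v hv w hw => C.symplecticForm_parityChecks hv hw) ?_ ?_ hv)
  · refine isCorrectable_of_fibers f _ hcor fun h hh q hq r hr hqA hrA => hf h hh q hq r hr ?_
    rw [Set.mem_ofPred_eq] at hqA hrA
    rw [hqA, hrA]
  · refine isCorrectable_of_fibers f _ hcor fun h hh q hq r hr hqA hrA => hf h hh q hq r hr ?_
    rw [Set.mem_compl_iff, Set.mem_ofPred_eq] at hqA hrA
    omega

/-- Without qubits the only vector is zero, which lies in the row space. This yields `0 < m` and `0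
< n` in the main theorem. -/
lemma StabilizerCode.IsMinDistance.nonempty {Q : Type} [Fintype Q] [DecidableEq Q]
    {C : StabilizerCode Q} {d : ℕ} (hd : C.IsMinDistance d) : Nonempty Q := by
  by_contra hQ
  rw [not_nonempty_iff] at hQ
  obtain ⟨v, -, hvS, -⟩ := hd.1
  exact hvS (Subsingleton.elim v 0 ▸ Submodule.zero_mem _)

/-! ### The Hermite constant -/

open MeasureTheory in
/-- Minkowski's theorem for balls: a lattice `L` of `ℝ^D` has a non-zero vector of norm at most
`2 (vol(L) / ω_D)^{1/D}`, where `ω_D` is the volume of the unit ball. -/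
lemma exists_ne_zero_norm_le_covolume {D : ℕ} (hD : 1 ≤ D)
    (L : Submodule ℤ (EuclideanSpace ℝ (Fin D))) [DiscreteTopology L] [IsZLattice ℝ L] :
    ∃ x ∈ L, x ≠ 0 ∧ ‖x‖ ≤ 2 * (ZLattice.covolume L /
      volume.real (Metric.closedBall (0 : EuclideanSpace ℝ (Fin D)) 1)) ^ (1 / (D : ℝ)) := by
  set ω := volume.real (Metric.closedBall (0 : EuclideanSpace ℝ (Fin D)) 1) with hω
  set V := ZLattice.covolume L with hV
  have hVpos : 0 < V := ZLattice.covolume_pos L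
  have hωtop : volume (Metric.closedBall (0 : EuclideanSpace ℝ (Fin D)) 1) ≠ ⊤ :=
    measure_closedBall_lt_top.ne
  have hωpos : 0 < ω :=
    ENNReal.toReal_pos (Metric.measure_closedBall_pos volume _ one_pos).ne' hωtop
  have : Nonempty (Fin D) := ⟨⟨0, hD⟩⟩
  -- The radius at which the ball has volume exactly `2^D * V`; equality suffices in Minkowski's
  -- theorem for a compact body.
  set r := 2 * (V / ω) ^ (1 / (D : ℝ)) with hr
  have hr0 : 0 ≤ r := by positivity
  have hrD : r ^ D * ω = V * 2 ^ D := by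
    have hD0 : (D : ℝ) ≠ 0 := by positivity
    rw [hr, mul_pow, ← Real.rpow_natCast ((V / ω) ^ (1 / (D : ℝ))), ← Real.rpow_mul (by positivity),
      one_div_mul_cancel hD0, Real.rpow_one]
    field_simp
  have : Module.Free ℤ L := ZLattice.module_free ℝ L
  have : Module.Finite ℤ L := ZLattice.module_finite ℝ L
  have hfund := ZLattice.isAddFundamentalDomain (Module.Free.chooseBasis ℤ L)
    (volume : Measure (EuclideanSpace ℝ (Fin D)))
  set F := ZSpan.fundamentalDomain ((Module.Free.chooseBasis ℤ L).ofZLatticeBasis ℝ)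
  have hF : volume F = ENNReal.ofReal V := by
    have hFtop : volume F ≠ ⊤ := (ZSpan.fundamentalDomain_isBounded _).measure_lt_top.ne
    rw [hV, ZLattice.covolume_eq_measure_fundamentalDomain L volume hfund,
      ofReal_measureReal hFtop]
  have : Countable L.toAddSubgroup := inferInstanceAs (Countable L)
  have : DiscreteTopology L.toAddSubgroup := inferInstanceAs (DiscreteTopology L)
  obtain ⟨x, hx0, hx⟩ := exists_ne_zero_mem_lattice_of_measure_mul_two_pow_le_measure
    (L := L.toAddSubgroup) (μ := volume) (s := Metric.closedBall 0 r) hfund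
    (fun x hx => by simpa using hx) (convex_closedBall _ _) (isCompact_closedBall _ _) (by
      rw [Measure.addHaar_closedBall' volume _ hr0, hF, finrank_euclideanSpace, Fintype.card_fin,
        ← ofReal_measureReal hωtop, ← ENNReal.ofReal_mul (by positivity), hrD,
        ENNReal.ofReal_mul hVpos.le]
      simp)
  exact ⟨x, x.2, by simpa using hx0, by simpa using hx⟩

lemma hermiteInvariant_le {D : ℕ} (L : Submodule ℤ (EuclideanSpace ℝ (Fin D)))
    {x : EuclideanSpace ℝ (Fin D)} (hx : x ∈ L) (hx0 : x ≠ 0) :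
    hermiteInvariant L ≤ (‖x‖ / ZLattice.covolume L ^ (1 / (D : ℝ))) ^ 2 :=
  csInf_le ⟨0, by rintro _ ⟨y, -, -, rfl⟩; positivity⟩ ⟨x, hx, hx0, rfl⟩

open MeasureTheory in
-- The real `sSup` is meaningful only for a bounded set; Minkowski's theorem supplies a bound
-- depending on `D` alone.
lemma hermiteInvariant_le_hermiteConstant {D : ℕ} (hD : 1 ≤ D)
    (L : Submodule ℤ (EuclideanSpace ℝ (Fin D))) [DiscreteTopology L] [IsZLattice ℝ L] :
    hermiteInvariant L ≤ hermiteConstant D := by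
  refine le_csSup ⟨(2 * (1 / volume.real
    (Metric.closedBall (0 : EuclideanSpace ℝ (Fin D)) 1)) ^ (1 / (D : ℝ))) ^ 2, ?_⟩
    ⟨L, inferInstance, inferInstance, rfl⟩
  rintro _ ⟨M, _, _, rfl⟩
  obtain ⟨x, hx, hx0, hle⟩ := exists_ne_zero_norm_le_covolume hD M
  refine (hermiteInvariant_le M hx hx0).trans ?_
  have hV : 0 < ZLattice.covolume M := ZLattice.covolume_pos M
  gcongr
  rw [div_le_iff₀ (by positivity), mul_assoc, ← Real.mul_rpow (by positivity) hV.le,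
    one_div_mul_eq_div]
  exact hle

/-- Only finitely many lattice points lie in the ball through one basis vector. Attaining the
minimum gives a vector satisfying the Hermite bound itself, with no loss of `ε`. -/
lemma exists_minimal_norm {D : ℕ} (hD : 1 ≤ D)
    (c : Module.Basis (Fin D) ℝ (EuclideanSpace ℝ (Fin D))) :
    ∃ u ∈ Submodule.span ℤ (Set.range c), u ≠ 0 ∧
      ∀ y ∈ Submodule.span ℤ (Set.range c), y ≠ 0 → ‖u‖ ≤ ‖y‖ := by
  set x := c ⟨0, hD⟩
  set T := (Metric.closedBall 0 ‖x‖ ∩ Submodule.span ℤ (Set.range c) :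
    Set (EuclideanSpace ℝ (Fin D))) \ {0}
  have hT : T.Finite := (ZSpan.setFinite_inter c Metric.isBounded_closedBall).sdiff
  have hxT : x ∈ T := ⟨⟨by simp, Submodule.subset_span ⟨_, rfl⟩⟩, c.ne_zero _⟩
  obtain ⟨u, hu, hmin⟩ := Set.exists_min_image T norm hT ⟨x, hxT⟩
  refine ⟨u, hu.1.2, hu.2, fun y hy hy0 => ?_⟩
  by_cases hyx : ‖y‖ ≤ ‖x‖
  · exact hmin y ⟨⟨by simpa using hyx, hy⟩, hy0⟩
  · exact (hmin x hxT).trans (not_le.1 hyx).le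

/-- A lattice with a basis has a non-zero vector attaining the Hermite bound. -/
lemma exists_norm_div_covolume_le_sqrt_hermiteConstant {D : ℕ} (hD : 1 ≤ D)
    (c : Module.Basis (Fin D) ℝ (EuclideanSpace ℝ (Fin D))) :
    ∃ u ∈ Submodule.span ℤ (Set.range c), u ≠ 0 ∧
      ‖u‖ / ZLattice.covolume (Submodule.span ℤ (Set.range c)) ^ (1 / (D : ℝ)) ≤
        √(hermiteConstant D) := by
  obtain ⟨u, hu, hu0, hmin⟩ := exists_minimal_norm hD c
  refine ⟨u, hu, hu0, Real.le_sqrt_of_sq_le (le_trans ?_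
    (hermiteInvariant_le_hermiteConstant hD (Submodule.span ℤ (Set.range c))))⟩
  refine le_csInf ⟨_, u, hu, hu0, rfl⟩ ?_
  rintro _ ⟨y, hy, hy0, rfl⟩
  have := hmin y hy hy0
  have := ZLattice.covolume_pos (Submodule.span ℤ (Set.range c))
  gcongr

open MeasureTheory in
lemma covolume_span_range_basis {D : ℕ}
    (c : Module.Basis (Fin D) ℝ (EuclideanSpace ℝ (Fin D))) :
    ZLattice.covolume (Submodule.span ℤ (Set.range c)) =
      |(EuclideanSpace.basisFun (Fin D) ℝ).toBasis.det c| := by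
  rw [ZLattice.covolume_eq_measure_fundamentalDomain _ volume
    (ZSpan.isAddFundamentalDomain' c volume),
    ZSpan.measureReal_fundamentalDomain c volume (EuclideanSpace.basisFun (Fin D) ℝ).toBasis,
    measureReal_congr (ZSpan.fundamentalDomain_ae_parallelepiped _ volume), measureReal_def,
    OrthonormalBasis.coe_toBasis, OrthonormalBasis.volume_parallelepiped, ENNReal.toReal_one,
    mul_one]

/-! ### The dual of an integer lattice -/

lemma inner_intVec {D : ℕ} (u : EuclideanSpace ℝ (Fin D)) (x : Fin D → ℤ) :
    inner ℝ u (intVec x) = ∑ i, u i * x i := by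
  simp [intVec, PiLp.inner_apply, mul_comm]

lemma inner_intVec_intVec {D : ℕ} (a x : Fin D → ℤ) :
    inner ℝ (intVec a) (intVec x) = ((∑ i, a i * x i : ℤ) : ℝ) := by
  rw [inner_intVec]
  simp [intVec]

/-- The dual of a sublattice of `ℤ^D` of index `n` contains a lattice of covolume `1 / n`. -/
lemma exists_basis_dual {D n : ℕ} (hn : 0 < n) (Λ : Submodule ℤ (Fin D → ℤ))
    (hrank : Module.finrank ℤ Λ = D) (hcard : Nat.card ((Fin D → ℤ) ⧸ Λ) = n) :
    ∃ c : Module.Basis (Fin D) ℝ (EuclideanSpace ℝ (Fin D)),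
      |(EuclideanSpace.basisFun (Fin D) ℝ).toBasis.det c| = (n : ℝ)⁻¹ ∧
      ∀ u ∈ Submodule.span ℤ (Set.range c), ∀ l ∈ Λ, ∃ k : ℤ, inner ℝ u (intVec l) = k := by
  let b : Module.Basis (Fin D) ℤ Λ := Module.finBasisOfFinrankEq ℤ Λ hrank
  let R : Matrix (Fin D) (Fin D) ℝ :=
    (Matrix.of fun i j => (b i : Fin D → ℤ) j).map (Int.cast : ℤ → ℝ)
  have hRdet : |R.det| = n := by
    have h1 := Submodule.natAbs_det_basis_change (Pi.basisFun ℤ (Fin D)) Λ b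
    rw [Pi.basisFun_det_apply] at h1
    have h2 : R.det = ((Matrix.of fun i j => (b i : Fin D → ℤ) j).det : ℤ) :=
      (Int.cast_det _).symm
    rw [h2, ← Int.cast_abs, Int.abs_eq_natAbs, ← hcard, ← h1]
    rfl
  have hRunit : IsUnit R.det := by
    refine isUnit_iff_ne_zero.2 fun h => ?_
    rw [h, abs_zero] at hRdet
    exact hn.ne (by exact_mod_cast hRdet)
  -- The rows of `R` are a basis of `Λ`, so the columns of `R⁻¹` are the dual basis.
  let v : Fin D → EuclideanSpace ℝ (Fin D) := fun j => WithLp.toLp 2 fun i => R⁻¹ i j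
  have hvdet : (EuclideanSpace.basisFun (Fin D) ℝ).toBasis.det v = R⁻¹.det := by
    rw [Module.Basis.det_apply]
    congr 1
  have hvunit : IsUnit ((EuclideanSpace.basisFun (Fin D) ℝ).toBasis.det v) := by
    rw [hvdet]
    exact Matrix.isUnit_nonsing_inv_det _ hRunit
  obtain ⟨hli, hsp⟩ := (Module.Basis.is_basis_iff_det _).2 hvunit
  refine ⟨Module.Basis.mk hli hsp.ge, ?_, ?_⟩
  · rw [Module.Basis.coe_mk, hvdet, Matrix.det_nonsing_inv, Ring.inverse_eq_inv', abs_inv, hRdet]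
  · rw [Module.Basis.coe_mk]
    intro u hu l hl
    have hb : ∀ i j, inner ℝ (v j) (intVec (b i : Fin D → ℤ)) = (1 : Matrix _ _ ℝ) i j :=
      fun i j => by
        rw [← Matrix.mul_nonsing_inv R hRunit, inner_intVec, Matrix.mul_apply]
        exact Finset.sum_congr rfl fun k _ => by simp [v, R, mul_comm]
    have hl' : l = ∑ i, b.repr ⟨l, hl⟩ i • (b i : Fin D → ℤ) := by
      have := congrArg Λ.subtype (b.sum_repr ⟨l, hl⟩)
      rw [map_sum] at this
      exact this.symm
    induction hu using Submodule.span_induction with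
    | mem x hx =>
      obtain ⟨j, rfl⟩ := hx
      refine ⟨b.repr ⟨l, hl⟩ j, ?_⟩
      have hl'' : intVec l = ∑ i, ((b.repr ⟨l, hl⟩ i : ℤ) : ℝ) • intVec (b i : Fin D → ℤ) := by
        ext k
        have := congrFun hl' k
        simp only [intVec, this, PiLp.toLp_apply, WithLp.ofLp_sum, Finset.sum_apply]
        simp
      rw [hl'', inner_sum]
      simp [inner_smul_right, hb, Matrix.one_apply]
    | zero => exact ⟨0, by simp⟩
    | add x y _ _ hx hy =>
      obtain ⟨k, hk⟩ := hx
      obtain ⟨k', hk'⟩ := hy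
      exact ⟨k + k', by rw [inner_add_left, hk, hk']; push_cast; rfl⟩
    | smul z x _ hx =>
      obtain ⟨k, hk⟩ := hx
      exact ⟨z * k, by rw [← Int.cast_smul_eq_zsmul ℝ, real_inner_smul_left, hk]; push_cast; rfl⟩

/-- A short integer vector `a` such that `a / n` belongs to the dual of `Λ`. -/
lemma exists_short_dual_vector {D n : ℕ} (hD : 1 ≤ D) (hn : 0 < n) (Λ : Submodule ℤ (Fin D → ℤ))
    (hrank : Module.finrank ℤ Λ = D) (hcard : Nat.card ((Fin D → ℤ) ⧸ Λ) = n) :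
    ∃ a : Fin D → ℤ, a ≠ 0 ∧ (∀ l ∈ Λ, (n : ℤ) ∣ ∑ i, a i * l i) ∧
      ‖intVec a‖ ≤ √(hermiteConstant D) * (n : ℝ) ^ (((D : ℝ) - 1) / D) := by
  obtain ⟨c, hdet, hdual⟩ := exists_basis_dual hn Λ hrank hcard
  obtain ⟨u, hu, hu0, hle⟩ := exists_norm_div_covolume_le_sqrt_hermiteConstant hD c
  rw [covolume_span_range_basis, hdet] at hle
  have hn' : (0 : ℝ) < n := by exact_mod_cast hn
  have hD' : (D : ℝ) ≠ 0 := by positivity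
  -- A group of order `n` is killed by `n`, so `n • e_i ∈ Λ`; pairing with `u` shows that each `n *
  -- u i` is an integer.
  have hnΛ : ∀ i, Pi.single i (n : ℤ) ∈ Λ := fun i => by
    have h1 : n • (Submodule.Quotient.mk (Pi.single i 1) : (Fin D → ℤ) ⧸ Λ) = 0 := by
      rw [← hcard]
      exact card_nsmul_eq_zero'
    rw [← Submodule.Quotient.mk_smul, Submodule.Quotient.mk_eq_zero] at h1
    convert h1 using 1
    ext j
    simp [Pi.single_apply]
  choose a ha using fun i => hdual u hu _ (hnΛ i)
  have hau : intVec a = (n : ℝ) • u := by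
    ext i
    have := ha i
    rw [inner_intVec] at this
    simp only [Pi.single_apply, Int.cast_ite, Int.cast_zero, mul_ite, mul_zero,
      Finset.sum_ite_eq', Finset.mem_univ, if_true, Int.cast_natCast] at this
    simp [intVec, ← this, mul_comm]
  refine ⟨a, ?_, fun l hl => ?_, ?_⟩
  · rintro rfl
    refine smul_ne_zero hn'.ne' hu0 (hau.symm.trans ?_)
    ext i
    simp [intVec]
  · obtain ⟨k, hk⟩ := hdual u hu l hl
    refine ⟨k, ?_⟩
    have := inner_intVec_intVec a l
    rw [hau, real_inner_smul_left, hk] at this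
    exact_mod_cast this.symm
  · rw [hau, norm_smul, Real.norm_natCast]
    rw [Real.inv_rpow hn'.le, div_inv_eq_mul] at hle
    calc (n : ℝ) * ‖u‖ = ‖u‖ * (n : ℝ) ^ (1 / (D : ℝ)) * (n : ℝ) ^ (((D : ℝ) - 1) / D) := by
          rw [mul_assoc, ← Real.rpow_add hn', show 1 / (D : ℝ) + ((D : ℝ) - 1) / D = 1 by
            field_simp; ring, Real.rpow_one, mul_comm]
      _ ≤ _ := by gcongr

/-! ### Counting vertices in a strip -/

/-- The count is at most a difference of ceilings. Its strict bound is the source of the strict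
inequality in the theorem. -/
lemma card_lt_of_mem_Ico (T : Finset ℕ) {x δ : ℝ} (hx : 0 ≤ x) (hδ : 0 ≤ δ)
    (hT : ∀ i ∈ T, x ≤ i ∧ (i : ℝ) < x + δ) : (T.card : ℝ) < δ + 1 := by
  have hsub : T ⊆ Finset.Ico ⌈x⌉₊ ⌈x + δ⌉₊ := fun i hi =>
    Finset.mem_Ico.2 ⟨Nat.ceil_le.2 (hT i hi).1, Nat.lt_ceil.2 (hT i hi).2⟩
  have hcard := Finset.card_le_card hsub
  rw [Nat.card_Ico] at hcard
  have hmono : ⌈x⌉₊ ≤ ⌈x + δ⌉₊ := Nat.ceil_mono (by linarith)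
  have h1 : (T.card : ℝ) ≤ (⌈x + δ⌉₊ : ℝ) - ⌈x⌉₊ := by
    rw [← Nat.cast_sub hmono]
    exact_mod_cast hcard
  have h2 := Nat.ceil_lt_add_one (show 0 ≤ x + δ by linarith)
  have h3 := Nat.le_ceil x
  linarith

/-- A homomorphism from a group of order `n` to `ℤ / n` with kernel of order `e` takes values in
the multiples of `e`, and each of the `s` equal slices of `ℤ / n` has fewer than `n / s + e`
preimages. -/
lemma exists_slice_bound {G : Type} [AddCommGroup G] {n : ℕ} [NeZero n] (hcard : Nat.card G = n)
    (φ : G →+ ZMod n) :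
    ∃ e : ℕ, 0 < e ∧ e ∣ n ∧ (∀ p, e ∣ (φ p).val) ∧ ∀ s j : ℕ, 0 < s →
      ({p | s * (φ p).val / n = j}.ncard : ℝ) < n / s + e := by
  classical
  have hn : 0 < n := Nat.pos_of_neZero n
  have hfin : Finite G := Nat.finite_of_card_ne_zero (hcard ▸ hn.ne')
  have : Fintype G := Fintype.ofFinite G
  have hek : Nat.card φ.ker * Nat.card φ.range = n := by
    rw [← AddSubgroup.index_ker, AddSubgroup.card_mul_index, hcard]
  set e := Nat.card φ.ker with he
  set k := Nat.card φ.range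
  have hepos : 0 < e := Nat.pos_of_ne_zero fun h => by simp [h] at hek; omega
  have hkpos : 0 < k := Nat.pos_of_ne_zero fun h => by simp [h] at hek; omega
  -- The image has order `k` with `e * k = n`, so `n` divides `k * (φ p).val`, and `k` cancels.
  have hdvd : ∀ p, e ∣ (φ p).val := fun p => by
    have h1 : k • (⟨φ p, p, rfl⟩ : φ.range) = 0 := card_nsmul_eq_zero'
    have h2 : ((k * (φ p).val : ℕ) : ZMod n) = 0 := by
      have := congrArg Subtype.val h1
      simpa [nsmul_eq_mul] using this
    rw [ZMod.natCast_eq_zero_iff] at h2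
    exact Nat.dvd_of_mul_dvd_mul_left hkpos ((dvd_of_eq ((mul_comm k e).trans hek)).trans h2)
  refine ⟨e, hepos, ⟨k, hek.symm⟩, hdvd, fun s j hs => ?_⟩
  set T : Finset G := Finset.univ.filter fun p => s * (φ p).val / n = j
  have hTcard : {p | s * (φ p).val / n = j}.ncard = T.card := by
    rw [← Set.ncard_coe_finset]
    congr 1
    ext p
    simp [T]
  -- Vertices with the same value differ by an element of the kernel, which has order `e`.
  have hfib : ∀ i ∈ T.image (fun p => (φ p).val / e),
      (T.filter fun p => (φ p).val / e = i).card ≤ e := fun i hi => by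
    obtain ⟨p₀, -, rfl⟩ := Finset.mem_image.1 hi
    refine le_of_le_of_eq ?_ (Nat.card_eq_card_toFinset (φ.ker : Set G)).symm
    refine Finset.card_le_card_of_injOn (fun p => p - p₀) (fun p hp => ?_)
      (fun p _ q _ h => sub_left_injective h)
    have hp' := (Finset.mem_filter.1 hp).2
    have hval : (φ p).val = (φ p₀).val := by
      rw [← Nat.div_mul_cancel (hdvd p), ← Nat.div_mul_cancel (hdvd p₀), hp']
    simp [AddMonoidHom.mem_ker, ZMod.val_injective n hval]
  have hle := Finset.card_le_mul_card_image T e hfib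
  have hn' : (0 : ℝ) < n := by exact_mod_cast hn
  have hs' : (0 : ℝ) < s := by exact_mod_cast hs
  have he' : (0 : ℝ) < e := by exact_mod_cast hepos
  -- After division by `e`, slice `j` becomes a half-open interval of length `n / (s * e)`.
  have himg := card_lt_of_mem_Ico (T.image fun p => (φ p).val / e) (x := j * n / (s * e))
    (δ := n / (s * e)) (by positivity) (by positivity) fun i hi => by
      obtain ⟨p, hp, rfl⟩ := Finset.mem_image.1 hi
      have hpj : s * (φ p).val / n = j := (Finset.mem_filter.1 hp).2
      have h1 : j * n ≤ s * (φ p).val := hpj ▸ Nat.div_mul_le_self _ _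
      have h2 : s * (φ p).val < (j + 1) * n := by
        rw [← hpj, mul_comm _ n]; exact Nat.lt_mul_div_succ _ hn
      have h3 : (((φ p).val / e : ℕ) : ℝ) * e = (φ p).val := by
        exact_mod_cast Nat.div_mul_cancel (hdvd p)
      have h1' : (j : ℝ) * n ≤ s * (φ p).val := by exact_mod_cast h1
      have h2' : (s : ℝ) * (φ p).val < (j + 1) * n := by exact_mod_cast h2
      rw [← h3] at h1' h2'
      rw [← add_div, div_le_iff₀ (by positivity), lt_div_iff₀ (by positivity)]
      constructor <;> linarith
  rw [hTcard]
  calc (T.card : ℝ) ≤ e * (T.image fun p => (φ p).val / e).card := by exact_mod_cast hle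
    _ < e * (n / (s * e) + 1) := by gcongr
    _ = n / s + e := by field_simp

/-- Two residues modulo `n` at circular distance at most `n / (2 s)` lie in equal or adjacent
slices, hence in the same slice if the slices have the same parity. -/
lemma slice_eq_of_parity_eq {n s V V' : ℕ} (hV : V < n) (hV' : V' < n) (hs : 0 < s) (K : ℤ)
    (hK : 2 * (s : ℤ) * |(V : ℤ) - V' - n * K| ≤ n)
    (hpar : 2 * s * V / n % 2 = 2 * s * V' / n % 2) : 2 * s * V / n = 2 * s * V' / n := by
  have hn : 0 < n := by omega
  have bounds : ∀ W : ℕ, W < n → ((2 * s * W / n : ℕ) : ℤ) * n ≤ 2 * s * W ∧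
      2 * (s : ℤ) * W < (((2 * s * W / n : ℕ) : ℤ) + 1) * n ∧ 2 * s * W / n < 2 * s :=
    fun W hW => ⟨by exact_mod_cast Nat.div_mul_le_self _ _,
      by rw [mul_comm _ (n : ℤ)]; exact_mod_cast Nat.lt_mul_div_succ _ hn,
      (Nat.div_lt_iff_lt_mul hn).2 (by gcongr)⟩
  obtain ⟨h1, h2, h3⟩ := bounds V hV
  obtain ⟨h1', h2', h3'⟩ := bounds V' hV'
  generalize 2 * s * V / n = j at *
  generalize 2 * s * V' / n = j' at *
  have hn' : (0 : ℤ) < n := by exact_mod_cast hn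
  have hs' : (0 : ℤ) < s := by exact_mod_cast hs
  have hup := mul_le_mul_of_nonneg_left (le_abs_self ((V : ℤ) - V' - n * K))
    (show 0 ≤ 2 * (s : ℤ) by positivity)
  have hlo := mul_le_mul_of_nonneg_left (neg_abs_le ((V : ℤ) - V' - n * K))
    (show 0 ≤ 2 * (s : ℤ) by positivity)
  -- Before rounding down, the positions differ by at most one slice modulo `2 * s`; rounding adds
  -- strictly less than one. The total number of slices is even, so parity is consistent around the
  -- circle and forces the difference, lying strictly between `-2` and `2`, to be zero.
  have hlt : (j : ℤ) - j' - 2 * (s * K) < 2 := by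
    refine lt_of_mul_lt_mul_right ?_ hn'.le
    linarith
  have hgt : -2 < (j : ℤ) - j' - 2 * (s * K) := by
    refine lt_of_mul_lt_mul_right ?_ hn'.le
    linarith
  have heq : (j : ℤ) - j' = 2 * (s * K) := by
    generalize (s : ℤ) * K = t at *
    omega
  have hK1 : K < 1 := by
    refine lt_of_mul_lt_mul_left (a := (s : ℤ)) ?_ hs'.le
    omega
  have hK2 : -1 < K := by
    refine lt_of_mul_lt_mul_left (a := (s : ℤ)) ?_ hs'.le
    omega
  have hK0 : K = 0 := by omega
  subst hK0
  omega

/-! ### The projection of `ℤ^D / Λ` along an integer vector -/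

/-- The homomorphism `ℤ^D / Λ → ℤ / n` induced by the scalar product with `a`. -/
def dotHom {D : ℕ} (n : ℕ) (Λ : Submodule ℤ (Fin D → ℤ)) (a : Fin D → ℤ)
    (ha : ∀ l ∈ Λ, (n : ℤ) ∣ ∑ i, a i * l i) : ((Fin D → ℤ) ⧸ Λ) →+ ZMod n :=
  QuotientAddGroup.lift Λ.toAddSubgroup
    { toFun := fun x => ((∑ i, a i * x i : ℤ) : ZMod n)
      map_zero' := by simp
      map_add' := fun x y => by
        rw [← Int.cast_add, ← Finset.sum_add_distrib]
        simp [mul_add] }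
    fun l hl => (ZMod.intCast_zmod_eq_zero_iff_dvd _ n).2 (ha l hl)

lemma dotHom_mk {D n : ℕ} {Λ : Submodule ℤ (Fin D → ℤ)} {a : Fin D → ℤ}
    (ha : ∀ l ∈ Λ, (n : ℤ) ∣ ∑ i, a i * l i) (x : Fin D → ℤ) :
    dotHom n Λ a ha (Submodule.Quotient.mk x) = ((∑ i, a i * x i : ℤ) : ZMod n) := rfl

/-- If `e` divides `n` and all the values of the projection along `a ≠ 0`, then `e ≤ ‖a‖`. -/
lemma le_norm_intVec_of_dvd_dotHom {D n e : ℕ} [NeZero n] {Λ : Submodule ℤ (Fin D → ℤ)}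
    {a : Fin D → ℤ} (ha0 : a ≠ 0) (ha : ∀ l ∈ Λ, (n : ℤ) ∣ ∑ i, a i * l i) (hen : e ∣ n)
    (he : ∀ p, e ∣ (dotHom n Λ a ha p).val) : (e : ℝ) ≤ ‖intVec a‖ := by
  obtain ⟨i, hi⟩ := Function.ne_iff.1 ha0
  have h1 := he (Submodule.Quotient.mk (Pi.single i 1))
  rw [dotHom_mk] at h1
  simp only [Pi.single_apply, mul_ite, mul_one, mul_zero, Finset.sum_ite_eq', Finset.mem_univ,
    if_true] at h1
  -- The `i`-th unit vector projects to `a i` modulo `n`; as `e ∣ n`, divisibility passes from the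
  -- residue to `a i`.
  have h2 : (e : ℤ) ∣ a i := by
    have h3 : (((a i : ZMod n).val : ℕ) : ℤ) = a i % n := ZMod.val_intCast _
    rw [← Int.emod_add_mul_ediv (a i) n]
    refine dvd_add ?_ (Dvd.dvd.mul_right (by exact_mod_cast hen) _)
    rw [← h3]
    exact_mod_cast h1
  have h4 : (e : ℤ) ≤ |a i| :=
    Int.le_of_dvd (abs_pos.2 hi) ((dvd_abs _ _).2 h2)
  calc (e : ℝ) ≤ ((|a i| : ℤ) : ℝ) := by exact_mod_cast h4
    _ = ‖(intVec a) i‖ := by simp [intVec]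
    _ ≤ ‖intVec a‖ := PiLp.norm_apply_le _ i

/-- The projections along `a` of two vertices in a ball of radius `ρ` are at circular distance at
most `2 ρ ‖a‖`. -/
lemma exists_abs_sub_le_of_mem_quotientBall {D n : ℕ} [NeZero n] {Λ : Submodule ℤ (Fin D → ℤ)}
    {a : Fin D → ℤ} (ha : ∀ l ∈ Λ, (n : ℤ) ∣ ∑ i, a i * l i) {ρ : ℝ}
    {c : EuclideanSpace ℝ (Fin D)} {p p' : (Fin D → ℤ) ⧸ Λ} (hp : p ∈ quotientBall Λ c ρ)
    (hp' : p' ∈ quotientBall Λ c ρ) :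
    ∃ K : ℤ, |((dotHom n Λ a ha p).val : ℝ) - (dotHom n Λ a ha p').val - n * K| ≤
      2 * ρ * ‖intVec a‖ := by
  obtain ⟨x, rfl, hx⟩ := hp
  obtain ⟨y, rfl, hy⟩ := hp'
  have hn' : (0 : ℝ) < n := by exact_mod_cast Nat.pos_of_neZero n
  set V : ℝ := (((dotHom n Λ a ha (Submodule.Quotient.mk x)).val : ℕ) : ℝ) with hVdef
  set W : ℝ := (((dotHom n Λ a ha (Submodule.Quotient.mk y)).val : ℕ) : ℝ) with hWdef
  have hval : ∀ z : Fin D → ℤ, ∃ k : ℤ,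
      ((dotHom n Λ a ha (Submodule.Quotient.mk z)).val : ℝ) =
        inner ℝ (intVec a) (intVec z) - n * k := fun z => by
    refine ⟨(∑ i, a i * z i) / n, ?_⟩
    rw [dotHom_mk, inner_intVec_intVec]
    have := ZMod.val_intCast (n := n) (∑ i, a i * z i)
    rw [Int.emod_def] at this
    exact_mod_cast this
  have hlat : ∀ g : Λ, ∃ k : ℤ, inner ℝ (intVec a) (intVec (g : Fin D → ℤ)) = n * k := fun g => by
    obtain ⟨k, hk⟩ := ha g g.2
    exact ⟨k, by rw [inner_intVec_intVec, hk]; push_cast; rfl⟩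
  -- The infimum in `quotientDist` is only approached here, so representatives are taken within `η`.
  -- The `+ 1` in `η` keeps the denominator positive even if `a = 0`.
  have key : ∀ ε > 0, ∃ K : ℤ, |V - W - n * K| ≤ 2 * ρ * ‖intVec a‖ + ε := fun ε hε => by
    set η := ε / (2 * (‖intVec a‖ + 1)) with hη
    have hηpos : 0 < η := by positivity
    obtain ⟨g, hg⟩ := exists_lt_of_ciInf_lt (lt_of_le_of_lt hx (lt_add_of_pos_right ρ hηpos))
    obtain ⟨h, hh⟩ := exists_lt_of_ciInf_lt (lt_of_le_of_lt hy (lt_add_of_pos_right ρ hηpos))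
    obtain ⟨k₁, hk₁⟩ := hval x
    obtain ⟨k₂, hk₂⟩ := hval y
    obtain ⟨k₃, hk₃⟩ := hlat g
    obtain ⟨k₄, hk₄⟩ := hlat h
    refine ⟨k₂ - k₁ + k₃ - k₄, ?_⟩
    have heq : V - W - n * ((k₂ - k₁ + k₃ - k₄ : ℤ) : ℝ) = inner ℝ (intVec a)
        ((intVec x - (c + intVec (g : Fin D → ℤ))) - (intVec y - (c + intVec (h : Fin D → ℤ)))) := by
      simp only [inner_sub_right, inner_add_right, hk₃, hk₄]
      rw [hVdef, hWdef, hk₁, hk₂]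
      push_cast
      ring
    rw [heq]
    calc _ ≤ ‖intVec a‖ * ((ρ + η) + (ρ + η)) :=
          (abs_real_inner_le_norm _ _).trans (by
            gcongr
            exact (norm_sub_le _ _).trans (add_le_add hg.le hh.le))
      _ = 2 * ρ * ‖intVec a‖ + ‖intVec a‖ / (‖intVec a‖ + 1) * ε := by
          rw [hη]; field_simp; ring
      _ ≤ 2 * ρ * ‖intVec a‖ + ε := by
          gcongr
          refine mul_le_of_le_one_left hε.le ((div_le_one (by positivity)).2 (by linarith))
  -- The integer from `key` may depend on `ε`. The nearest integer does at least as well for every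
  -- `ε`, so `ε` can tend to zero.
  refine ⟨round ((V - W) / n), le_of_forall_pos_le_add fun ε hε => ?_⟩
  obtain ⟨K, hK⟩ := key ε hε
  have hscale : ∀ k : ℤ, |V - W - n * k| = n * |(V - W) / n - k| := fun k => by
    rw [← abs_of_pos hn', ← abs_mul, abs_of_pos hn']
    congr 1
    field_simp
  calc |V - W - n * (round ((V - W) / n) : ℤ)| ≤ |V - W - n * K| := by
        rw [hscale, hscale]
        exact mul_le_mul_of_nonneg_left (round_le _ _) hn'.le
    _ ≤ _ := hK

/-! ### From vertices to qubits, and the distance bound -/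

lemma ncard_preimage_le_mul {α β : Type} [Finite α] [Finite β] (f : α → β) {m : ℕ}
    (hf : ∀ p, (f ⁻¹' {p}).ncard = m) (T : Set β) : (f ⁻¹' T).ncard ≤ m * T.ncard := by
  classical
  have : Fintype α := Fintype.ofFinite α
  have : Fintype β := Fintype.ofFinite β
  rw [Set.ncard_eq_toFinset_card', Set.ncard_eq_toFinset_card']
  refine Finset.card_le_mul_card_image_of_maps_to (f := f) (fun q hq => by simpa using hq) m
    fun p _ => ?_
  rw [← hf p, Set.ncard_eq_toFinset_card']
  exact Finset.card_le_card fun q hq => by simpa using (Finset.mem_filter.1 hq).2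

theorem theorem1 (D m n : ℕ) (hD : 1 ≤ D)
    (Λ : Submodule ℤ (Fin D → ℤ)) (hrank : Module.finrank ℤ Λ = D)
    (hcard : Nat.card ((Fin D → ℤ) ⧸ Λ) = n)
    (C : StabilizerCode (Fin (m * n)))
    (vertex : Fin (m * n) → (Fin D → ℤ) ⧸ Λ)
    (hvertex : ∀ p, (vertex ⁻¹' {p}).ncard = m)
    (ρ : ℝ) (hρ : 0 < ρ)
    (hlocal : ∀ h ∈ C.parityChecks, ∃ c : EuclideanSpace ℝ (Fin D),
      ∀ q ∈ h.support, vertex q ∈ quotientBall Λ c ρ)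
    (hn : 8 * ρ * √(hermiteConstant D) ≤ (n : ℝ) ^ (1 / (D : ℝ)))
    (d : ℕ) (hd : C.IsMinDistance d) :
    (d : ℝ) < m * √(hermiteConstant D) * (√(D : ℝ) + 4 * ρ) * (n : ℝ) ^ (((D : ℝ) - 1) / D) := by
  have hmn : 0 < m * n := Fin.pos_iff_nonempty.2 hd.nonempty
  have hnpos : 0 < n := Nat.pos_of_mul_pos_left hmn
  have hmpos : 0 < m := Nat.pos_of_mul_pos_right hmn
  have : NeZero n := ⟨hnpos.ne'⟩
  have : Finite ((Fin D → ℤ) ⧸ Λ) := Nat.finite_of_card_ne_zero (hcard ▸ hnpos.ne')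
  have hn' : (0 : ℝ) < n := by exact_mod_cast hnpos
  have hm' : (0 : ℝ) < m := by exact_mod_cast hmpos
  have hD' : (1 : ℝ) ≤ D := by exact_mod_cast hD
  obtain ⟨a, ha0, ha, hanorm⟩ := exists_short_dual_vector hD hnpos Λ hrank hcard
  set φ := dotHom n Λ a ha
  obtain ⟨e, hepos, hen, hedvd, hcount⟩ := exists_slice_bound hcard φ
  have heA : (e : ℝ) ≤ ‖intVec a‖ := le_norm_intVec_of_dvd_dotHom ha0 ha hen hedvd
  set A := ‖intVec a‖
  have hApos : 0 < A := lt_of_lt_of_le (by exact_mod_cast hepos) heA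
  have hAn : 8 * ρ * A ≤ n := by
    calc 8 * ρ * A ≤ 8 * ρ * (√(hermiteConstant D) * (n : ℝ) ^ (((D : ℝ) - 1) / D)) := by gcongr
      _ = 8 * ρ * √(hermiteConstant D) * (n : ℝ) ^ (((D : ℝ) - 1) / D) := by ring
      _ ≤ (n : ℝ) ^ (1 / (D : ℝ)) * (n : ℝ) ^ (((D : ℝ) - 1) / D) := by gcongr
      _ = n := by
        rw [← Real.rpow_add hn', show 1 / (D : ℝ) + ((D : ℝ) - 1) / D = 1 by
          field_simp; ring, Real.rpow_one]
  -- With `s = ⌊y⌋₊`, `s ≤ y` makes slices at least `2ρA` wide, as locality requires, while `y ≤ 2 *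
  -- s` keeps them at most `4ρA` wide.
  set y := n / (4 * ρ * A)
  have hy : n = y * (4 * ρ * A) := by simp only [y]; field_simp
  have hy2 : 2 ≤ y := by rw [le_div_iff₀ (by positivity)]; linarith
  set s := ⌊y⌋₊
  have hs : 0 < s := Nat.floor_pos.2 (by linarith)
  have hsy : (s : ℝ) ≤ y := Nat.floor_le (by linarith)
  have hys : y ≤ 2 * s := by
    have h1 := Nat.lt_floor_add_one y
    have h2 : (1 : ℝ) ≤ s := by exact_mod_cast hs
    linarith
  have hs' : (0 : ℝ) < s := by exact_mod_cast hs
  obtain ⟨j, hj⟩ := hd.exists_le_ncard_fiber (fun q => 2 * s * (φ (vertex q)).val / n)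
    fun h hh q hq r hr hpar => by
      obtain ⟨c, hc⟩ := hlocal h hh
      obtain ⟨K, hK⟩ := exists_abs_sub_le_of_mem_quotientBall ha (hc q hq) (hc r hr)
      refine slice_eq_of_parity_eq (ZMod.val_lt _) (ZMod.val_lt _) hs K ?_ hpar
      have : 2 * (s : ℝ) *
          |((φ (vertex q)).val : ℝ) - (φ (vertex r)).val - n * K| ≤ n := by
        calc _ ≤ 2 * (s : ℝ) * (2 * ρ * A) := by gcongr
          _ = s * (4 * ρ * A) := by ring
          _ ≤ y * (4 * ρ * A) := by gcongr
          _ = n := hy.symm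
      exact_mod_cast this
  have hfib := ncard_preimage_le_mul vertex hvertex {p | 2 * s * (φ p).val / n = j}
  have hslice := hcount (2 * s) j (by omega)
  have hwidth : (n : ℝ) / (2 * s : ℕ) ≤ 4 * ρ * A := by
    push_cast
    rw [div_le_iff₀ (by positivity)]
    calc (n : ℝ) = y * (4 * ρ * A) := hy
      _ ≤ 2 * s * (4 * ρ * A) := by gcongr
      _ = _ := by ring
  calc (d : ℝ) ≤ m * ({p | 2 * s * (φ p).val / n = j}.ncard : ℝ) := by
        exact_mod_cast hj.trans hfib
    _ < m * (n / (2 * s : ℕ) + e) := by gcongr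
    _ ≤ m * (4 * ρ * A + A) := by gcongr
    _ = m * A * (1 + 4 * ρ) := by ring
    -- The argument gives the factor `1 + 4ρ`; it is weakened to the stated one by `1 ≤ √D`.
    _ ≤ m * (√(hermiteConstant D) * (n : ℝ) ^ (((D : ℝ) - 1) / D)) * (√(D : ℝ) + 4 * ρ) := by
        gcongr
        exact Real.one_le_sqrt.2 hD'
    _ = _ := by ring
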